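/- Let $N\in\mathbb N$. Points of $(\mathbb R^{1+1})^N$ are written $(t_1,z_1,\dots,t_N,z_N)$ with $x_k^0=t_k$, $x_k^1=z_k$. Let $$\mathscr S_1=\{(t_j-t_k)^2-(z_j-z_k)^2<0\ \ \forall j\neq k,\quad z_1<\dots<z_N\},$$ $$\mathscr C_{k,k+1}=\{x\in\overline{\mathscr S_1}: t_k=t_{k+1},\ z_k=z_{k+1}\}\ (k=1,\dots,N-1),\qquad \mathscr C_1=\{x\in\partial\mathscr S_1:\ \exists k:\ t_k=t_{k+1},\ z_k=z_{k+1}\}.$$ Let $\psi:\overline{\mathscr S_1}\to(\mathbb C^2)^{\otimes N}$, with components $\psi_{s_1\dots s_N}$, $s_k\in\{-,+\}$ (the first basis vector of $\mathbb C^2$ being labelled $-$, the second $+$), be continuous, be $C^1$ on $\mathscr S_1$, and solve the multi-time Dirac equations $\sum_{\mu=0}^1 i\gamma_k^\mu\,\partial_{k,\mu}\psi=0$, $k=1,\dots,N$, on $\mathscr S_1$. Here $\partial_{k,\mu}=\partial/\partial x_k^\mu$, $\gamma^0=\sigma_1$, $\gamma^1=\sigma_1\sigma_3$, and $\gamma_k^\mu$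 is $\gamma^\mu$ acting on the spin index of the $k$-th particle. Let $j^{\mu_1\dots\mu_N}=\psi^\dagger\gamma_1^0\cdots\gamma_N^0\,\gamma_1^{\mu_1}\cdots\gamma_N^{\mu_N}\psi$ be the tensor current and $$\omega_j=\sum_{\mu_1,\dots,\mu_N\in\{0,1\}}(-1)^{\mu_1+\dots+\mu_N}\,j^{\mu_1\dots\mu_N}\;dx_1^{1-\mu_1}\wedge\dots\wedge dx_N^{1-\mu_N}$$ the current form. We write $\omega_j|_{\mathscr C_1}=0$ if at each point of $\mathscr C_1$ the restriction of $\omega_j$ to the tangent directions $\{dt_k=dt_{k+1},\ dz_k=dz_{k+1}\}$ of every $\mathscr C_{k,k+1}$ through that point is zero. A space-like hypersurface is a graph $\Sigma=\{(t_\Sigma(z),z):z\in\mathbb R\}$ with $t_\Sigma:\mathbb R\to\mathbb R$ smooth and $|t_\Sigma'|<1$; it is a Cauchy surface if it meets every light-like line. A function on a subset of $\mathbb R^{2N}$ is called compactly supported if the set where it is non-zero is bounded. For space-like hypersurfaces $\Sigma,\Sigma'$ let $V(\Sigma,\Sigma')$ be the set of $(t_1,z_1,\dots,t_N,z_N)\in\overline{\mathscr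 S_1}$ for which there is $\tau\in[0,1]$ with $t_k=t_\Sigma(z_k)+\tau(t_{\Sigma'}(z_k)-t_\Sigma(z_k))$ for all $k$. Probability is conserved between $\Sigma$ and $\Sigma'$ if $$\int_{\Sigma^N\cap\mathscr S_1}\omega_j=\int_{(\Sigma')^N\cap\mathscr S_1}\omega_j ,$$ where both integrals converge absolutely, and $\Sigma^N$, $(\Sigma')^N$ are oriented by $dz_1\wedge\dots\wedge dz_N$. 1. Suppose that $\omega_j|_{\mathscr C_1}=0$. If $\psi$ is compactly supported on $\Sigma^N\cap\mathscr S_1$ for all space-like Cauchy surfaces $\Sigma$, then probability is conserved between any two space-like Cauchy surfaces. Moreover, probability is conserved between any two space-like hypersurfaces $\Sigma,\Sigma'$ (Cauchy or not) for which $\psi$ is compactly supported on $V(\Sigma,\Sigma')$. 2. Let $\varphi^{(k)}\in(-\pi,\pi]$ for $k=1,\dots,N-1$, and suppose that $$\psi_{s_1\dots s_{k-1}+-s_{k+2}\dots s_N}=e^{i\varphi^{(k)}}\,\psi_{s_1\dots s_{k-1}-+s_{k+2}\dots s_N}\quad\text{on }\mathscr C_{k,k+1},\qquad k=1,\dots,N-1,$$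 for all values of the remaining spin indices. Then $\omega_j|_{\mathscr C_1}=0$, and consequently probability is conserved in both cases of part 1, under the same compact support assumptions. -/

import Mathlib

noncomputable section

namespace MultiTime

/-! ### Configurations, spinors, gamma matrices -/

/-- Configuration space-time `(ℝ^{1+1})^N`: `x k 0 = t_k` is the time and `x k 1 = z_k` the space
coordinate of the `k`-th particle. -/
abbrev Config (N : ℕ) : Type := Fin N → Fin 2 → ℝ

/-- The spin space `(ℂ²)^{⊗ N}`, in components: `φ s` is the component `φ_{s_1 … s_N}`.
The spin index `0 : Fin 2` (first component of `ℂ²`) stands for `-`, and `1` stands for `+`. -/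
abbrev Spinor (N : ℕ) : Type := (Fin N → Fin 2) → ℂ

/-- The Dirac matrices `γ⁰ = σ₁`, `γ¹ = σ₁ σ₃`. -/
def gamma : Fin 2 → Matrix (Fin 2) (Fin 2) ℂ :=
  ![!![0, 1; 1, 0], !![0, -1; 1, 0]]

/-- The operator `A_1 ⊗ ⋯ ⊗ A_N` on `(ℂ²)^{⊗ N}`. -/
def tensorOp {N : ℕ} (A : Fin N → Matrix (Fin 2) (Fin 2) ℂ) (φ : Spinor N) : Spinor N :=
  fun s => ∑ r : Fin N → Fin 2, (∏ k, A k (s k) (r k)) * φ r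

/-- The matrix `A` acting on the spin index of the `k`-th particle only. -/
def actOn {N : ℕ} (k : Fin N) (A : Matrix (Fin 2) (Fin 2) ℂ) : Spinor N → Spinor N :=
  tensorOp (Function.update (fun _ => 1) k A)

/-- The partial derivative `∂_{k,μ} ψ`. -/
def partialDeriv {N : ℕ} (k : Fin N) (μ : Fin 2) (ψ : Config N → Spinor N) (x : Config N) :
    Spinor N :=
  fderiv ℝ ψ x (Pi.single k (Pi.single μ 1))

/-- `ψ` solves the system `i γ_k^μ ∂_{k,μ} ψ = 0`, `k = 1, …, N`, on the open set `Ω`. -/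
def SolvesDirac {N : ℕ} (ψ : Config N → Spinor N) (Ω : Set (Config N)) : Prop :=
  ∀ x ∈ Ω, ∀ k : Fin N,
    Complex.I • ∑ μ : Fin 2, actOn k (gamma μ) (partialDeriv k μ ψ x) = 0

/-! ### The domain and its coincidence set -/

/-- The set `𝒮` of space-like configurations. -/
def spacelikeConfigs (N : ℕ) : Set (Config N) :=
  {x | ∀ j k : Fin N, j ≠ k → (x j 0 - x k 0) ^ 2 - (x j 1 - x k 1) ^ 2 < 0}

/-- The part `𝒮₁` of `𝒮` on which `z_1 < ⋯ < z_N`. -/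
def orderedConfigs (N : ℕ) : Set (Config N) :=
  {x | x ∈ spacelikeConfigs N ∧ StrictMono fun k => x k 1}

/-- The first particle of the `k`-th pair `(k, k+1)` of neighbours. -/
def lo {N : ℕ} (k : Fin (N - 1)) : Fin N := ⟨k, by omega⟩

/-- The second particle of the `k`-th pair `(k, k+1)` of neighbours. -/
def hi {N : ℕ} (k : Fin (N - 1)) : Fin N := ⟨k + 1, by omega⟩

/-- The set `𝒞_{k,k+1}`. -/
def pairCoincidence {N : ℕ} (k : Fin (N - 1)) : Set (Config N) :=
  {x | x ∈ closure (orderedConfigs N) ∧ x (lo k) 0 = x (hi k) 0 ∧ x (lo k) 1 = x (hi k) 1}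

/-- The coincidence set `𝒞₁`. -/
def coincidenceSet (N : ℕ) : Set (Config N) :=
  {x | x ∈ frontier (orderedConfigs N) ∧
    ∃ k : Fin (N - 1), x (lo k) 0 = x (hi k) 0 ∧ x (lo k) 1 = x (hi k) 1}

/-- The directions tangent to `𝒞_{k,k+1}`: those with `dt_k = dt_{k+1}` and `dz_k = dz_{k+1}`. -/
def coincidenceDirections {N : ℕ} (k : Fin (N - 1)) : Submodule ℝ (Config N) where
  carrier := {v | v (lo k) = v (hi k)}
  add_mem' := by
    intro a b ha hb
    simp only [Set.mem_ofPred_eq, Pi.add_apply] at *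
    rw [ha, hb]
  zero_mem' := by simp
  smul_mem' := by
    intro c a ha
    simp only [Set.mem_ofPred_eq, Pi.smul_apply] at *
    rw [ha]

/-! ### The tensor current and the current form -/

/-- The expression `φ̄ γ_1^{μ_1} ⋯ γ_N^{μ_N} φ` with `φ̄ = φ† γ_1^0 ⋯ γ_N^0`. -/
def currentComplex {N : ℕ} (φ : Spinor N) (μ : Fin N → Fin 2) : ℂ :=
  ∑ s, star (φ s) * tensorOp (fun _ => gamma 0) (tensorOp (fun k => gamma (μ k)) φ) s

/-- The tensor current `j^{μ_1 … μ_N}`, as a real number. -/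
def current {N : ℕ} (φ : Spinor N) (μ : Fin N → Fin 2) : ℝ := (currentComplex φ μ).re

theorem tensorOp_comp {N : ℕ} (A B : Fin N → Matrix (Fin 2) (Fin 2) ℂ) (φ : Spinor N) :
    tensorOp A (tensorOp B φ) = tensorOp (fun k => A k * B k) φ := by
  funext s
  simp only [tensorOp, Matrix.mul_apply]
  simp_rw [Finset.prod_univ_sum, Finset.mul_sum, Finset.sum_mul]
  rw [Finset.sum_comm]
  refine Finset.sum_congr rfl fun r _ => ?_
  rw [Fintype.piFinset_univ]
  refine Finset.sum_congr rfl fun q _ => ?_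
  rw [Finset.prod_mul_distrib, mul_assoc]

/-- The tensor current is real, so that no information is lost in `current`. -/
theorem currentComplex_eq {N : ℕ} (φ : Spinor N) (μ : Fin N → Fin 2) :
    currentComplex φ μ = (current φ μ : ℂ) := by
  have hM : ∀ (m a b : Fin 2),
      star ((gamma 0 * gamma m) a b) = (gamma 0 * gamma m) b a := by
    intro m a b
    fin_cases m <;> fin_cases a <;> fin_cases b <;> simp [gamma]
  have h : star (currentComplex φ μ) = currentComplex φ μ := by
    simp only [currentComplex, tensorOp_comp]
    simp only [tensorOp, Finset.mul_sum, star_sum, star_mul', star_star, star_prod, hM]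
    rw [Finset.sum_comm]
    refine Finset.sum_congr rfl fun s _ => Finset.sum_congr rfl fun r _ => ?_
    ring
  exact (Complex.conj_eq_iff_re.mp h).symm

/-- The coordinates `x_k^{ν_k}`, `k = 1, …, N`, as one linear map. -/
def coordinates {N : ℕ} (ν : Fin N → Fin 2) : Config N →ₗ[ℝ] (Fin N → ℝ) where
  toFun v k := v k (ν k)
  map_add' _ _ := rfl
  map_smul' _ _ := rfl

/-- The form `dx_1^{ν_1} ∧ ⋯ ∧ dx_N^{ν_N}`, that is,
`(v_1, …, v_N) ↦ det (dx_k^{ν_k}(v_i))_{i,k}`. -/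
def wedge {N : ℕ} (ν : Fin N → Fin 2) : (Config N) [⋀^Fin N]→ₗ[ℝ] ℝ :=
  (Matrix.detRowAlternating (R := ℝ) (n := Fin N)).compLinearMap (coordinates ν)

/-- The current form `ω_j` at the point `x`. For `d = 1`, omitting `dx_k^{μ_k}` from
`dx_k^0 ∧ dx_k^1` leaves `dx_k^{1 - μ_k}`. -/
def currentForm {N : ℕ} (ψ : Config N → Spinor N) (x : Config N) :
    (Config N) [⋀^Fin N]→ₗ[ℝ] ℝ :=
  ∑ μ : Fin N → Fin 2,
    ((-1 : ℝ) ^ (∑ k, (μ k : ℕ)) * current (ψ x) μ) • wedge (fun k => 1 - μ k)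

/-- `ω_j` vanishes on `𝒞₁`: at each point of `𝒞₁`, its restriction (pull-back) to every piece
`𝒞_{k,k+1}` through this point is zero. -/
def CurrentFormVanishes {N : ℕ} (ψ : Config N → Spinor N) : Prop :=
  ∀ x ∈ coincidenceSet N, ∀ k : Fin (N - 1), x ∈ pairCoincidence k →
    (currentForm ψ x).compLinearMap (coincidenceDirections k).subtype = 0

/-- The phase boundary conditions
`ψ_{… + - …} = e^{i φ^{(k)}} ψ_{… - + …}` on `𝒞_{k,k+1}`, `k = 1, …, N-1`. -/
def PhaseBoundaryConditions {N : ℕ} (φ : Fin (N - 1) → ℝ) (ψ : Config N → Spinor N) : Prop :=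
  ∀ k : Fin (N - 1), ∀ x ∈ pairCoincidence k, ∀ s : Fin N → Fin 2,
    ψ x (Function.update (Function.update s (lo k) 1) (hi k) 0) =
      Complex.exp (Complex.I * (φ k : ℂ)) *
        ψ x (Function.update (Function.update s (lo k) 0) (hi k) 1)

/-! ### Space-like hypersurfaces and probability conservation -/

/-- A smooth space-like hypersurface of `1+1`-dimensional Minkowski space-time, with exactly one
point `(time z, z)` for each `z`. -/
structure SpacelikeHypersurface where
  /-- the function `t_Σ` -/
  time : ℝ → ℝ
  smooth : ContDiff ℝ (⊤ : ℕ∞) time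
  spacelike : ∀ z, |deriv time z| < 1

/-- `S` is a Cauchy surface: it meets every light-like line. -/
def SpacelikeHypersurface.IsCauchy (S : SpacelikeHypersurface) : Prop :=
  ∀ c : ℝ, (∃ z, z + S.time z = c) ∧ ∃ z, z - S.time z = c

/-- The set `Σ^N`. -/
def SpacelikeHypersurface.power (S : SpacelikeHypersurface) (N : ℕ) : Set (Config N) :=
  {x | ∀ k, x k 0 = S.time (x k 1)}

/-- The parametrization `(z_1, …, z_N) ↦ (t_Σ(z_1), z_1, …, t_Σ(z_N), z_N)` of `Σ^N`. -/
def SpacelikeHypersurface.param (S : SpacelikeHypersurface) {N : ℕ} (z : Fin N → ℝ) : Config N :=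
  fun k => ![S.time (z k), z k]

/-- The parameters of the points of `Σ^N ∩ 𝒮₁`. -/
def SpacelikeHypersurface.domain (S : SpacelikeHypersurface) (N : ℕ) : Set (Fin N → ℝ) :=
  {z | S.param z ∈ orderedConfigs N}

/-- The pull-back of the `N`-form `ω` to `Σ^N`, as a density with respect to
`dz_1 ∧ ⋯ ∧ dz_N`. -/
def SpacelikeHypersurface.pullback (S : SpacelikeHypersurface) {N : ℕ}
    (ω : Config N → (Config N) [⋀^Fin N]→ₗ[ℝ] ℝ) (z : Fin N → ℝ) : ℝ :=
  ω (S.param z) fun k => fderiv ℝ (S.param (N := N)) z (Pi.single k 1)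

/-- `∫_{Σ^N ∩ 𝒮₁} ω`, with `Σ^N` oriented by `dz_1 ∧ ⋯ ∧ dz_N`. -/
def SpacelikeHypersurface.integral (S : SpacelikeHypersurface) {N : ℕ}
    (ω : Config N → (Config N) [⋀^Fin N]→ₗ[ℝ] ℝ) : ℝ :=
  ∫ z in S.domain N, S.pullback ω z

/-- The integrals of `ω_j` over `Σ^N ∩ 𝒮₁` and `(Σ')^N ∩ 𝒮₁` exist and agree. -/
def ProbabilityConserved {N : ℕ} (ψ : Config N → Spinor N) (S S' : SpacelikeHypersurface) : Prop :=
  MeasureTheory.IntegrableOn (S.pullback (currentForm ψ)) (S.domain N) ∧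
  MeasureTheory.IntegrableOn (S'.pullback (currentForm ψ)) (S'.domain N) ∧
  S.integral (currentForm ψ) = S'.integral (currentForm ψ)

/-- The region of `closure 𝒮₁` swept by the hypersurfaces interpolating between `Σ` and `Σ'`. -/
def sweptRegion (N : ℕ) (S S' : SpacelikeHypersurface) : Set (Config N) :=
  {x | x ∈ closure (orderedConfigs N) ∧ ∃ τ ∈ Set.Icc (0 : ℝ) 1,
    ∀ k, x k 0 = S.time (x k 1) + τ * (S'.time (x k 1) - S.time (x k 1))}

/-- `ψ` is compactly supported on `A`: the points of `A` at which `ψ` does not vanish lie in a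
compact subset of configuration space-time. -/
def CompactlySupportedOn {N : ℕ} (ψ : Config N → Spinor N) (A : Set (Config N)) : Prop :=
  IsCompact (closure {x | x ∈ A ∧ ψ x ≠ 0})

end MultiTime

end

noncomputable section

namespace MultiTime

open MeasureTheory Filter Topology

/-! Since `γ⁰γ^μ` is diagonal in the chosen spin basis, no cross terms between components occur and
`ω_j = ∑_s |ψ_s|² ⋀_k (dz_k - ε(s_k) dt_k)` (`currentForm_apply`). The Dirac equations make `ψ_s` a
function of the null coordinates `u_k = z_k - ε(s_k) t_k` alone (`eq_of_nullCoord_eq`), so each term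
is a density in `u` in which the hypersurface no longer appears.

Vanishing of `ω_j` on `𝒞₁` amounts to `SwapInvariant`: exchanging the spins of two coinciding
neighbours preserves `|ψ_s|`. Phase conditions give this because a phase has modulus one. Exchanging
neighbouring labels `(u_k, s_k)` of opposite spin then costs nothing, and sorting by such exchanges
shows that `|ψ_s|` is the restriction of one symmetric function of the `N` labels, defined for every
`u ∈ ℝ^N` (`norm_eq_sortedNorm`). By symmetry the ordering constraint can be dropped: `N!` times the
probability on `Σ` is the integral of a fixed density over the `u` reached by `Σ^N`
(`factorial_mul_lintegral`).

Thus `Σ` matters only through the set of `u` it reaches. For a Cauchy surface this is all of `ℝ^N`.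
Otherwise, compact support on `V(Σ, Σ')` prevents the point that realises a given `u` of nonzero
density from escaping to infinity while `Σ` is deformed into `Σ'`, so the two sets agree wherever
the density is nonzero (`mem_range_nullMap_of_sortedDensity_ne_zero`). Compact support also gives
integrability. -/

/-- The sign `ε(e)`: `1` for the spin index `-`, and `-1` for `+`. -/
def chi (e : Fin 2) : ℝ := (-1) ^ (e : ℕ)

@[simp] theorem chi_zero : chi 0 = 1 := by simp [chi]

@[simp] theorem chi_one : chi 1 = -1 := by simp [chi]

/-- The null coordinate `z - ε(e) t` of a point of `ℝ^{1+1}`. -/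
def nullCoord (e : Fin 2) (p : Fin 2 → ℝ) : ℝ := p 1 - chi e * p 0

/-! ### The current form in terms of the components of the wave function -/

/-- As `σ₁² = 1`, the product is `1` or `σ₃`; hence the current involves only the `|ψ_s|²`. -/
theorem gamma_zero_mul (m : Fin 2) :
    gamma 0 * gamma m = Matrix.diagonal fun e => ((chi e ^ (m : ℕ) : ℝ) : ℂ) := by
  ext a b
  fin_cases m <;> fin_cases a <;> fin_cases b <;> simp [gamma, Matrix.mul_apply]

theorem tensorOp_diagonal {N : ℕ} (d : Fin N → Fin 2 → ℂ) (φ : Spinor N) (s : Fin N → Fin 2) :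
    tensorOp (fun k => Matrix.diagonal (d k)) φ s = (∏ k, d k (s k)) * φ s := by
  rw [tensorOp, Finset.sum_eq_single s]
  · simp
  · intro r _ hr
    obtain ⟨k, hk⟩ := Function.ne_iff.mp hr
    rw [Finset.prod_eq_zero (Finset.mem_univ k), zero_mul]
    exact Matrix.diagonal_apply_ne' _ hk
  · simp

theorem current_eq {N : ℕ} (φ : Spinor N) (μ : Fin N → Fin 2) :
    current φ μ = ∑ s, ‖φ s‖ ^ 2 * ∏ k, chi (s k) ^ (μ k : ℕ) := by
  have h : currentComplex φ μ =
      ((∑ s, ‖φ s‖ ^ 2 * ∏ k, chi (s k) ^ (μ k : ℕ) : ℝ) : ℂ) := by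
    simp only [currentComplex, tensorOp_comp, gamma_zero_mul, tensorOp_diagonal]
    push_cast
    refine Finset.sum_congr rfl fun s _ => ?_
    rw [← Complex.conj_mul']
    simp only [Complex.star_def]
    ring
  rw [current, h, Complex.ofReal_re]

/-- The matrix `(dz_k - ε(s_k) dt_k)(v_i)`. -/
def nullMatrix {N : ℕ} (s : Fin N → Fin 2) (v : Fin N → Config N) : Matrix (Fin N) (Fin N) ℝ :=
  Matrix.of fun i k => nullCoord (s k) (v i k)

/-- Multilinear expansion of the determinant in its columns: column `k` is `dz_k` (for `μ_k = 0`)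
plus `-ε(s_k) dt_k` (for `μ_k = 1`). -/
theorem sum_wedge {N : ℕ} (s : Fin N → Fin 2) (v : Fin N → Config N) :
    ∑ μ : Fin N → Fin 2, (∏ k, (-chi (s k)) ^ (μ k : ℕ)) * wedge (fun k => 1 - μ k) v =
      (nullMatrix s v).det := by
  have h : ∀ k, (nullMatrix s v).transpose k =
      ∑ m : Fin 2, ((-chi (s k)) ^ (m : ℕ)) • fun i => v i k (1 - m) := by
    intro k
    funext i
    simp [nullMatrix, nullCoord]
    ring
  rw [← Matrix.det_transpose]
  have := (Matrix.detRowAlternating (R := ℝ) (n := Fin N)).toMultilinearMap.map_sum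
    (fun k (m : Fin 2) => ((-chi (s k)) ^ (m : ℕ)) • fun i => v i k (1 - m))
  simp only [← h] at this
  refine Eq.trans ?_ this.symm
  refine Finset.sum_congr rfl fun μ _ => ?_
  rw [MultilinearMap.map_smul_univ, smul_eq_mul]
  congr 1
  exact (Matrix.det_transpose _).symm

theorem currentForm_apply {N : ℕ} (ψ : Config N → Spinor N) (x : Config N)
    (v : Fin N → Config N) :
    currentForm ψ x v = ∑ s, ‖ψ x s‖ ^ 2 * (nullMatrix s v).det := by
  have hsum : currentForm ψ x v = ∑ μ : Fin N → Fin 2,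
      ((-1 : ℝ) ^ (∑ k, (μ k : ℕ)) * current (ψ x) μ) * wedge (fun k => 1 - μ k) v :=
    map_sum (⟨⟨fun f : (Config N) [⋀^Fin N]→ₗ[ℝ] ℝ => f v, rfl⟩, fun _ _ => rfl⟩ :
      (Config N) [⋀^Fin N]→ₗ[ℝ] ℝ →+ ℝ) _ _
  rw [hsum]
  simp only [← sum_wedge, current_eq, Finset.mul_sum, Finset.sum_mul]
  rw [Finset.sum_comm]
  refine Finset.sum_congr rfl fun s _ => Finset.sum_congr rfl fun μ _ => ?_
  have : ∏ k, (-chi (s k)) ^ (μ k : ℕ) =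
      (-1) ^ (∑ k, (μ k : ℕ)) * ∏ k, chi (s k) ^ (μ k : ℕ) := by
    rw [← Finset.prod_pow_eq_pow_sum, ← Finset.prod_mul_distrib]
    exact Finset.prod_congr rfl fun k _ => by rw [← mul_pow, neg_one_mul]
  rw [this]
  ring

/-! ### The boundary condition in terms of components -/

/-- On `𝒞_{k,k+1}`, the absolute values of the components of `ψ` do not change when the spin indices
of the particles `k` and `k + 1` are exchanged. -/
def SwapInvariant {N : ℕ} (ψ : Config N → Spinor N) : Prop :=
  ∀ k : Fin (N - 1), ∀ x ∈ pairCoincidence k, ∀ s : Fin N → Fin 2,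
    ‖ψ x (s ∘ Equiv.swap (lo k) (hi k))‖ = ‖ψ x s‖

theorem lo_ne_hi {N : ℕ} (k : Fin (N - 1)) : lo k ≠ hi k := by
  simp [lo, hi]

theorem comp_swap_eq_self {N : ℕ} {α : Type*} {i j : Fin N} {s : Fin N → α} (h : s i = s j) :
    s ∘ Equiv.swap i j = s := by
  funext l
  rcases eq_or_ne l i with rfl | hi
  · simp [h]
  rcases eq_or_ne l j with rfl | hj
  · simp [h]
  · simp [Equiv.swap_apply_of_ne_of_ne hi hj]

theorem pairCoincidence_subset {N : ℕ} (k : Fin (N - 1)) :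
    pairCoincidence k ⊆ coincidenceSet N := by
  rintro x ⟨hx, h0, h1⟩
  refine ⟨⟨hx, fun h => ?_⟩, k, h0, h1⟩
  have := (interior_subset h).1 (lo k) (hi k) (lo_ne_hi k)
  rw [h0, h1] at this
  simp at this

/-- On tangent vectors the particles `k` and `k + 1` have equal entries, so exchanging their spins
exchanges two columns of `nullMatrix`. The weights are unchanged and the determinant changes sign,
so the sum equals its own negative. -/
theorem SwapInvariant.currentFormVanishes {N : ℕ} {ψ : Config N → Spinor N}
    (h : SwapInvariant ψ) : CurrentFormVanishes ψ := by
  intro x _ k hk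
  ext v
  set w : Fin N → Config N := fun i => (v i : Config N) with hw
  have hv : ∀ i, w i (lo k) = w i (hi k) := fun i => (v i).2
  change currentForm ψ x w = 0
  rw [currentForm_apply]
  have key : ∑ s, ‖ψ x s‖ ^ 2 * (nullMatrix s w).det =
      -∑ s, ‖ψ x s‖ ^ 2 * (nullMatrix s w).det := by
    conv_lhs => rw [← (Equiv.arrowCongr (Equiv.swap (lo k) (hi k)) (Equiv.refl (Fin 2))).sum_comp]
    rw [← Finset.sum_neg_distrib]
    refine Finset.sum_congr rfl fun s _ => ?_
    have h1 : Equiv.arrowCongr (Equiv.swap (lo k) (hi k)) (Equiv.refl (Fin 2)) s =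
        s ∘ Equiv.swap (lo k) (hi k) := by
      funext l; simp [Equiv.arrowCongr]
    rw [h1, h k x hk s]
    have h2 : nullMatrix (s ∘ Equiv.swap (lo k) (hi k)) w =
        (nullMatrix s w).submatrix id (Equiv.swap (lo k) (hi k)) := by
      ext i l
      have : w i l = w i (Equiv.swap (lo k) (hi k) l) := by
        have := congrFun (comp_swap_eq_self (s := w i) (hv i)) l
        exact this.symm
      simp only [nullMatrix, Matrix.of_apply, Matrix.submatrix_apply, id, Function.comp]
      rw [← this]
    rw [h2, Matrix.det_permute', Equiv.Perm.sign_swap (lo_ne_hi k)]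
    simp
  linarith

theorem PhaseBoundaryConditions.swapInvariant {N : ℕ} {ψ : Config N → Spinor N}
    {φ : Fin (N - 1) → ℝ} (h : PhaseBoundaryConditions φ ψ) : SwapInvariant ψ := by
  intro k x hx s
  have key : ∀ r : Fin N → Fin 2, r (lo k) = 1 → r (hi k) = 0 →
      ‖ψ x (r ∘ Equiv.swap (lo k) (hi k))‖ = ‖ψ x r‖ := by
    intro r h1 h0
    have hphase := h k x hx r
    have e1 : Function.update (Function.update r (lo k) 1) (hi k) 0 = r := by
      rw [← h1, Function.update_eq_self, ← h0, Function.update_eq_self]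
    have e2 : Function.update (Function.update r (lo k) 0) (hi k) 1 =
        r ∘ Equiv.swap (lo k) (hi k) := by
      rw [← h1, ← h0, Equiv.comp_swap_eq_update]
      funext l
      rcases eq_or_ne l (lo k) with rfl | hl
      · simp [lo_ne_hi]
      rcases eq_or_ne l (hi k) with rfl | hl'
      · simp [(lo_ne_hi k).symm]
      · simp [hl, hl']
    rw [e1, e2] at hphase
    rw [hphase, norm_mul, mul_comm Complex.I, Complex.norm_exp_ofReal_mul_I, one_mul]
  rcases eq_or_ne (s (lo k)) (s (hi k)) with he | he
  · rw [comp_swap_eq_self he]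
  · rcases Fin.exists_fin_two.mp ⟨s (lo k), rfl⟩ with h0 | h1
    · have h1 : s (hi k) = 1 := by omega
      have := key (s ∘ Equiv.swap (lo k) (hi k)) (by simp [h1]) (by simp [← h0])
      rw [← this]
      congr 2
      funext l
      simp
    · exact key s h1 (by omega)

/-- The vector of `ℝ^{1+1}` on which `dz - ε(e') dt` is `1` for `e' = e` and `0` otherwise. -/
def dualNull (e : Fin 2) : Fin 2 → ℝ := ![-chi e / 2, 1 / 2]

theorem nullCoord_dualNull (e e' : Fin 2) :
    nullCoord e' (dualNull e) = if e' = e then 1 else 0 := by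
  fin_cases e <;> fin_cases e' <;> norm_num [nullCoord, dualNull]

/-- The form is tested on tangent vectors chosen so that only the components `s` and `s ∘ τ`
contribute, with opposite signs. -/
theorem CurrentFormVanishes.swapInvariant {N : ℕ} {ψ : Config N → Spinor N}
    (h : CurrentFormVanishes ψ) : SwapInvariant ψ := by
  intro k x hx s
  rcases eq_or_ne (s (lo k)) (s (hi k)) with he | he
  · rw [comp_swap_eq_self he]
  have hform := h x (pairCoincidence_subset k hx) k hx
  set τ := Equiv.swap (lo k) (hi k) with hτ
  -- Vector `i` is dual to `dz - ε(s_i) dt` and sits in the slots `i` and `τ i`: in both slots of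
  -- the pair if `i` belongs to it, which makes the vector tangent, and in slot `i` alone otherwise.
  let w : Fin N → Config N := fun i l => if l = i ∨ l = τ i then dualNull (s i) else 0
  have hw : ∀ i, w i ∈ coincidenceDirections k := by
    intro i
    change w i (lo k) = w i (hi k)
    have : (lo k = i ∨ lo k = τ i) ↔ (hi k = i ∨ hi k = τ i) := by
      rw [hτ, eq_comm (a := lo k) (b := Equiv.swap _ _ i),
        eq_comm (a := hi k) (b := Equiv.swap _ _ i),
        Equiv.swap_apply_eq_iff, Equiv.swap_apply_eq_iff, Equiv.swap_apply_left,
        Equiv.swap_apply_right, or_comm, eq_comm (a := i), eq_comm (a := i)]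
    simp only [w, this]
  have h0 : ∑ r, ‖ψ x r‖ ^ 2 * (nullMatrix r w).det = 0 := by
    rw [← currentForm_apply]
    exact DFunLike.congr_fun hform fun i => ⟨w i, hw i⟩
  have hsum : ∑ r, ‖ψ x r‖ ^ 2 * (nullMatrix r w).det = ‖ψ x s‖ ^ 2 - ‖ψ x (s ∘ τ)‖ ^ 2 := by
    have hentry : ∀ r i l, nullMatrix r w i l =
        if (l = i ∨ l = τ i) ∧ r l = s i then 1 else 0 := by
      intro r i l
      by_cases hl : l = i ∨ l = τ i
      · simp [nullMatrix, w, hl, nullCoord_dualNull]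
      · simp [nullMatrix, w, hl, nullCoord]
    have hprod : ∀ r (σ : Equiv.Perm (Fin N)), ∏ l, nullMatrix r w (σ l) l =
        if (∀ l, l = σ l ∨ l = τ (σ l)) ∧ r = s ∘ σ then 1 else 0 := by
      intro r σ
      simp only [hentry, Finset.prod_ite_zero, Finset.prod_const_one, Finset.mem_univ,
        forall_true_left]
      simp only [forall_and, funext_iff, Function.comp]
    -- Only `1` and `τ` survive in the Leibniz formula, and each selects the single index `r = s ∘
    -- σ`.
    have hσ : ∀ σ : Equiv.Perm (Fin N), (∀ l, l = σ l ∨ l = τ (σ l)) ↔ σ = 1 ∨ σ = τ := by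
      intro σ
      constructor
      · intro hl
        by_cases hlo : lo k = σ (lo k)
        · left
          ext1 l
          rcases hl l with h1 | h1
          · simpa using h1.symm
          · rcases eq_or_ne (σ l) (lo k) with h2 | h2
            · rw [hlo] at h2
              rw [σ.injective h2]; simpa using hlo.symm
            · rcases eq_or_ne (σ l) (hi k) with h3 | h3
              · rw [h3, hτ, Equiv.swap_apply_right] at h1
                subst h1
                exact absurd h3 (by rw [← hlo]; exact lo_ne_hi k)
              · rw [hτ, Equiv.swap_apply_of_ne_of_ne h2 h3] at h1
                simpa using h1.symm
        · right
          have h1 : σ (lo k) = hi k := by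
            have := (hl (lo k)).resolve_left hlo
            rw [hτ, eq_comm, Equiv.swap_apply_eq_iff, Equiv.swap_apply_left] at this
            exact this
          ext1 l
          rcases hl l with h2 | h2
          · rcases eq_or_ne l (lo k) with h3 | h3
            · rw [h3, h1, hτ, Equiv.swap_apply_left]
            · rcases eq_or_ne l (hi k) with h4 | h4
              · rw [h4, ← h1] at h2
                exact absurd (σ.injective h2).symm (by rw [h1]; exact (lo_ne_hi k).symm)
              · rw [← h2, hτ, Equiv.swap_apply_of_ne_of_ne h3 h4]
          · conv_rhs => rw [h2]
            simp [hτ]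
      · rintro (rfl | rfl) l
        · simp
        · right; simp [hτ]
    have h1τ : (1 : Equiv.Perm (Fin N)) ≠ τ := by
      intro h1
      have := Equiv.congr_fun h1 (lo k)
      rw [hτ, Equiv.swap_apply_left] at this
      exact lo_ne_hi k this
    simp only [Matrix.det_apply', hprod, hσ, Finset.mul_sum]
    rw [Finset.sum_comm]
    have hinner : ∀ σ : Equiv.Perm (Fin N),
        ∑ r, ‖ψ x r‖ ^ 2 * (((Equiv.Perm.sign σ : ℤ) : ℝ) *
          if (σ = 1 ∨ σ = τ) ∧ r = s ∘ σ then 1 else 0) =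
        if σ = 1 ∨ σ = τ then ‖ψ x (s ∘ σ)‖ ^ 2 * ((Equiv.Perm.sign σ : ℤ) : ℝ) else 0 := by
      intro σ
      by_cases hs : σ = 1 ∨ σ = τ
      · simp [hs]
      · simp [hs]
    simp only [hinner]
    rw [← Finset.sum_filter]
    have : (Finset.univ.filter fun σ : Equiv.Perm (Fin N) => σ = 1 ∨ σ = τ) = {1, τ} := by
      ext σ; simp
    rw [this, Finset.sum_pair h1τ]
    have : Equiv.Perm.sign τ = -1 := Equiv.Perm.sign_swap (lo_ne_hi k)
    simp [this]
    ring
  rw [hsum] at h0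
  have := sub_eq_zero.mp h0
  exact ((sq_eq_sq₀ (norm_nonneg _) (norm_nonneg _)).mp this).symm

/-! ### The configurations in null coordinates -/

/-- The interval `Δt² - Δz²` is minus the product of the two null differences, and their sum is
`2Δz`; so ordered and space-like means that both are positive. -/
theorem mem_orderedConfigs_iff {N : ℕ} {x : Config N} :
    x ∈ orderedConfigs N ↔ ∀ e, StrictMono fun k => nullCoord e (x k) := by
  rw [Fin.forall_fin_two]
  constructor
  · rintro ⟨hx, hz⟩
    have key : ∀ i j, i < j → |x j 0 - x i 0| < x j 1 - x i 1 := by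
      intro i j hij
      have h := hx j i hij.ne'
      have hz' := hz hij
      simp only at hz'
      exact abs_lt_of_sq_lt_sq (by linarith) (by linarith)
    refine ⟨fun i j hij => ?_, fun i j hij => ?_⟩ <;>
    · have := abs_lt.mp (key i j hij)
      simp only [nullCoord, chi_zero, chi_one]
      linarith
  · rintro ⟨h0, h1⟩
    have key : ∀ i j, i < j →
        x i 1 - x i 0 < x j 1 - x j 0 ∧ x i 1 + x i 0 < x j 1 + x j 0 := by
      intro i j hij
      have := h0 hij
      have := h1 hij
      simp only [nullCoord, chi_zero, chi_one] at *
      constructor <;> linarith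
    refine ⟨fun i j hij => ?_, fun i j hij => ?_⟩
    · rcases lt_or_gt_of_ne hij with h | h
      · nlinarith [key _ _ h, mul_pos (sub_pos.mpr (key _ _ h).1) (sub_pos.mpr (key _ _ h).2)]
      · nlinarith [key _ _ h, mul_pos (sub_pos.mpr (key _ _ h).1) (sub_pos.mpr (key _ _ h).2)]
    · have := key i j hij
      simp only
      linarith

theorem continuous_nullCoord {N : ℕ} (e : Fin 2) (k : Fin N) :
    Continuous fun x : Config N => nullCoord e (x k) := by
  unfold nullCoord
  fun_prop

theorem isOpen_orderedConfigs (N : ℕ) : IsOpen (orderedConfigs N) := by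
  have : orderedConfigs N = ⋂ (e : Fin 2) (i : Fin N) (j : Fin N) (_ : i < j),
      {x | nullCoord e (x i) < nullCoord e (x j)} := by
    ext x
    simp [mem_orderedConfigs_iff, StrictMono]
  rw [this]
  refine isOpen_iInter_of_finite fun e => isOpen_iInter_of_finite fun i =>
    isOpen_iInter_of_finite fun j => isOpen_iInter_of_finite fun _ => ?_
  exact isOpen_lt (continuous_nullCoord e i) (continuous_nullCoord e j)

/-- The configuration obtained from `x` by moving the `k`-th particle by `ε k` in space. -/
def spread {N : ℕ} (x : Config N) (ε : ℝ) : Config N := fun k => ![x k 0, x k 1 + ε * k]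

theorem nullCoord_spread {N : ℕ} (x : Config N) (ε : ℝ) (e : Fin 2) (k : Fin N) :
    nullCoord e (spread x ε k) = nullCoord e (x k) + ε * k := by
  simp [nullCoord, spread]
  ring

theorem spread_mem {N : ℕ} {x : Config N} (hx : ∀ e, Monotone fun k => nullCoord e (x k))
    {ε : ℝ} (hε : 0 < ε) : spread x ε ∈ orderedConfigs N := by
  rw [mem_orderedConfigs_iff]
  intro e i j hij
  simp only [nullCoord_spread]
  have h1 := hx e hij.le
  have h2 : (i : ℝ) < j := by exact_mod_cast hij
  have := mul_lt_mul_of_pos_left h2 hε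
  simp only at h1
  linarith

theorem tendsto_spread {N : ℕ} (x : Config N) : Tendsto (spread x) (𝓝[>] 0) (𝓝 x) := by
  have hc : Continuous (spread x) := by
    refine continuous_pi fun k => continuous_pi fun m => ?_
    fin_cases m <;> simp [spread] <;> fun_prop
  have h0 : spread x 0 = x := by
    funext k m
    fin_cases m <;> simp [spread]
  have := hc.tendsto 0
  rw [h0] at this
  exact this.mono_left nhdsWithin_le_nhds

/-- `spread` adds `ε k` to both null coordinates of particle `k`, which turns weak inequalities into
strict ones for every `ε > 0`. -/
theorem mem_closure_orderedConfigs_iff {N : ℕ} {x : Config N} :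
    x ∈ closure (orderedConfigs N) ↔ ∀ e, Monotone fun k => nullCoord e (x k) := by
  constructor
  · intro hx e i j hij
    have hcl : IsClosed {x : Config N | nullCoord e (x i) ≤ nullCoord e (x j)} :=
      isClosed_le (continuous_nullCoord e i) (continuous_nullCoord e j)
    exact closure_minimal (fun y hy => (mem_orderedConfigs_iff.mp hy e).monotone hij) hcl hx
  · intro hx
    refine mem_closure_of_tendsto (tendsto_spread x) ?_
    filter_upwards [self_mem_nhdsWithin] with ε hε using spread_mem hx hε

theorem convex_orderedConfigs (N : ℕ) : Convex ℝ (orderedConfigs N) := by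
  intro x hx y hy a b ha hb hab
  rw [mem_orderedConfigs_iff] at *
  intro e i j hij
  have h1 := hx e hij
  have h2 := hy e hij
  have hlin : ∀ l, nullCoord e ((a • x + b • y) l) =
      a * nullCoord e (x l) + b * nullCoord e (y l) := by
    intro l
    simp [nullCoord]
    ring
  simp only [hlin] at *
  rcases ha.eq_or_lt with rfl | ha'
  · have : b = 1 := by linarith
    subst this
    linarith
  · nlinarith [mul_lt_mul_of_pos_left h1 ha', mul_le_mul_of_nonneg_left h2.le hb]

/-- The configuration with null coordinates `c 0` and `c 1`. -/
def ofNull {N : ℕ} (c : Fin 2 → Fin N → ℝ) : Config N :=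
  fun k => ![(c 1 k - c 0 k) / 2, (c 0 k + c 1 k) / 2]

theorem nullCoord_ofNull {N : ℕ} (c : Fin 2 → Fin N → ℝ) (e : Fin 2) (k : Fin N) :
    nullCoord e (ofNull c k) = c e k := by
  fin_cases e <;> simp [nullCoord, ofNull] <;> ring

/-! ### Propagation along the null lines -/

theorem actOn_apply {N : ℕ} (k : Fin N) (A : Matrix (Fin 2) (Fin 2) ℂ) (φ : Spinor N)
    (s : Fin N → Fin 2) :
    actOn k A φ s = ∑ e, A (s k) e * φ (Function.update s k e) := by
  have hinj : Function.Injective fun e => Function.update s k e := Function.update_injective s k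
  refine (Fintype.sum_of_injective _ hinj _ _ (fun r hr => ?_) fun e => ?_).symm
  · obtain ⟨l, hl⟩ : ∃ l, l ≠ k ∧ s l ≠ r l := by
      by_contra! hc
      refine hr ⟨r k, funext fun l => ?_⟩
      rcases eq_or_ne l k with rfl | hl
      · simp
      · simp [hl, hc l hl]
    rw [Finset.prod_eq_zero (Finset.mem_univ l), zero_mul]
    simp [hl.1, hl.2]
  · rw [Finset.prod_eq_single k]
    · simp
    · intro l _ hl
      simp [hl]
    · simp

theorem SolvesDirac.partialDeriv_eq {N : ℕ} {ψ : Config N → Spinor N} {Ω : Set (Config N)}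
    (h : SolvesDirac ψ Ω) {x : Config N} (hx : x ∈ Ω) (k : Fin N) (s : Fin N → Fin 2) :
    partialDeriv k 0 ψ x s + chi (s k) * partialDeriv k 1 ψ x s = 0 := by
  -- Both `γ^μ` are off-diagonal, so component `s` appears in the row of the flipped spin index.
  have h1 := congrFun (h x hx k) (Function.update s k (1 - s k))
  simp only [Pi.smul_apply, Fin.sum_univ_two, Pi.add_apply, actOn_apply, smul_eq_mul,
    Pi.zero_apply, mul_eq_zero, Complex.I_ne_zero, false_or, Function.update_self,
    Function.update_idem] at h1
  rcases Fin.exists_fin_two.mp ⟨s k, rfl⟩ with h0 | h0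
  · have e1 : Function.update s k 0 = s := by rw [← h0, Function.update_eq_self]
    rw [h0] at h1 ⊢
    simpa [gamma, e1] using h1
  · have e1 : Function.update s k 1 = s := by rw [← h0, Function.update_eq_self]
    rw [h0] at h1 ⊢
    simpa [gamma, e1] using h1

theorem SolvesDirac.fderiv_eq_zero {N : ℕ} {ψ : Config N → Spinor N} {Ω : Set (Config N)}
    (h : SolvesDirac ψ Ω) {x : Config N} (hx : x ∈ Ω) {s : Fin N → Fin 2} {v : Config N}
    (hv : ∀ k, nullCoord (s k) (v k) = 0) : fderiv ℝ ψ x v s = 0 := by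
  have hdec : v = ∑ k, v k 0 • ((Pi.single k (Pi.single 0 1) : Config N) +
      chi (s k) • (Pi.single k (Pi.single 1 1) : Config N)) := by
    funext l m
    rw [Finset.sum_apply, Finset.sum_apply, Finset.sum_eq_single l]
    · have := hv l
      simp only [nullCoord] at this
      fin_cases m
      · simp
      · simp
        linarith
    · intro k _ hk
      simp [hk.symm]
    · simp
  rw [hdec, map_sum, Finset.sum_apply]
  refine Finset.sum_eq_zero fun k _ => ?_
  have := h.partialDeriv_eq hx k s
  simp only [partialDeriv] at this
  rw [map_smul, map_add, map_smul, Pi.smul_apply, Pi.add_apply, Pi.smul_apply, Complex.real_smul,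
    Complex.real_smul, this, mul_zero]

/-- By convexity the segment from `x` to `y` stays in the domain, and its direction is annihilated
by all `dz_k - ε(s_k) dt_k`, so the derivative of `ψ_s` along it is zero. -/
theorem eq_of_nullCoord_eq_of_mem {N : ℕ} {ψ : Config N → Spinor N}
    (hdiff : ContDiffOn ℝ 1 ψ (orderedConfigs N)) (hdirac : SolvesDirac ψ (orderedConfigs N))
    {s : Fin N → Fin 2} {x y : Config N} (hx : x ∈ orderedConfigs N) (hy : y ∈ orderedConfigs N)
    (hxy : ∀ k, nullCoord (s k) (x k) = nullCoord (s k) (y k)) : ψ x s = ψ y s := by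
  have hseg : ∀ τ ∈ Set.Icc (0 : ℝ) 1, x + τ • (y - x) ∈ orderedConfigs N := by
    intro τ hτ
    exact (convex_orderedConfigs N).add_smul_sub_mem hx hy hτ
  have hder : ∀ τ ∈ Set.Icc (0 : ℝ) 1,
      HasDerivAt (fun τ : ℝ => ψ (x + τ • (y - x)) s) 0 τ := by
    intro τ hτ
    have hd : HasFDerivAt ψ (fderiv ℝ ψ (x + τ • (y - x))) (x + τ • (y - x)) :=
      ((hdiff.differentiableOn (by norm_num)).differentiableAt
        ((isOpen_orderedConfigs N).mem_nhds (hseg τ hτ))).hasFDerivAt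
    have hl : HasDerivAt (fun τ : ℝ => x + τ • (y - x)) (y - x) τ := by
      simpa using ((hasDerivAt_id τ).smul_const (y - x)).const_add x
    have h := hasDerivAt_pi.mp (hd.comp_hasDerivAt τ hl) s
    have h0 := hdirac.fderiv_eq_zero (hseg τ hτ) (s := s) (v := y - x) (fun k => by
      have := hxy k
      simp only [nullCoord, Pi.sub_apply] at *
      linarith)
    rw [h0] at h
    exact h
  have := constant_of_has_deriv_right_zero
    (fun τ hτ => (hder τ hτ).continuousAt.continuousWithinAt)
    (fun τ hτ => (hder τ ⟨hτ.1, hτ.2.le⟩).hasDerivWithinAt) 1 (by simp)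
  simpa using this.symm

/-- Spreading both points by the same `ε` preserves equality of the null coordinates; continuity
then carries the interior statement to the boundary. -/
theorem eq_of_nullCoord_eq {N : ℕ} {ψ : Config N → Spinor N}
    (hcont : ContinuousOn ψ (closure (orderedConfigs N)))
    (hdiff : ContDiffOn ℝ 1 ψ (orderedConfigs N)) (hdirac : SolvesDirac ψ (orderedConfigs N))
    {s : Fin N → Fin 2} {x y : Config N} (hx : x ∈ closure (orderedConfigs N))
    (hy : y ∈ closure (orderedConfigs N))
    (hxy : ∀ k, nullCoord (s k) (x k) = nullCoord (s k) (y k)) : ψ x s = ψ y s := by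
  have hlim : ∀ w ∈ closure (orderedConfigs N),
      Tendsto (fun ε => ψ (spread w ε) s) (𝓝[>] 0) (𝓝 (ψ w s)) := by
    intro w hw
    have hw' : Tendsto (spread w) (𝓝[>] 0) (𝓝[closure (orderedConfigs N)] w) := by
      refine tendsto_nhdsWithin_iff.mpr ⟨tendsto_spread w, ?_⟩
      filter_upwards [self_mem_nhdsWithin] with ε hε
      exact subset_closure (spread_mem (mem_closure_orderedConfigs_iff.mp hw) hε)
    exact (tendsto_pi_nhds.mp ((hcont w hw).tendsto.comp hw')) s
  refine tendsto_nhds_unique (hlim x hx) ((hlim y hy).congr' ?_)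
  filter_upwards [self_mem_nhdsWithin] with ε hε
  refine (eq_of_nullCoord_eq_of_mem hdiff hdirac
    (spread_mem (mem_closure_orderedConfigs_iff.mp hx) hε)
    (spread_mem (mem_closure_orderedConfigs_iff.mp hy) hε) fun k => ?_).symm
  rw [nullCoord_spread, nullCoord_spread, hxy k]

/-! ### Sorting the null coordinates -/

theorem monotone_of_lo_le_hi {N : ℕ} {α : Type*} [Preorder α] {f : Fin N → α}
    (h : ∀ k : Fin (N - 1), f (lo k) ≤ f (hi k)) : Monotone f := by
  cases N with
  | zero => exact fun i => i.elim0
  | succ n => exact Fin.monotone_iff_le_succ.mpr h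

/-- Bubble sort as a minimisation: the lexicographically least rearrangement satisfying `P` has no
descent, since swapping at a descent would make it smaller. Sorted rearrangements agree as tuples.
-/
theorem adjacent_sort_induction {N : ℕ} {α : Type*} [LinearOrder α] (f : Fin N → α)
    (P : (Fin N → α) → Prop) (hf : P f)
    (h : ∀ (g : Fin N → α) (k : Fin (N - 1)), P g → g (hi k) < g (lo k) →
      P (g ∘ Equiv.swap (lo k) (hi k))) : P (f ∘ Tuple.sort f) := by
  let A : Set (Fin N → α) := {g | (∃ σ : Equiv.Perm (Fin N), g = f ∘ σ) ∧ P g}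
  have hfin : A.Finite :=
    (Set.finite_range fun σ : Equiv.Perm (Fin N) => f ∘ σ).subset
      fun g ⟨⟨σ, hσ⟩, _⟩ => ⟨σ, hσ.symm⟩
  obtain ⟨g, ⟨⟨σ, rfl⟩, hg⟩, hmin⟩ := Set.exists_min_image A toLex hfin ⟨f, ⟨1, rfl⟩, hf⟩
  have hmono : Monotone (f ∘ σ) := by
    refine monotone_of_lo_le_hi fun k => ?_
    by_contra! hk
    have h1 := hmin _ ⟨⟨σ * Equiv.swap (lo k) (hi k), rfl⟩, h _ k hg hk⟩
    exact absurd (Pi.lex_desc (Fin.mk_le_mk.mpr (Nat.le_succ _)) hk) (not_lt_of_ge h1)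
  rwa [← Tuple.comp_sort_eq_comp_iff_monotone.mpr hmono]

/-- Component `s` sees one null coordinate per particle and the other is free. With opposite spins,
the free coordinates of the pair can be chosen so that the two particles coincide; there
`SwapInvariant` applies. -/
theorem exists_swap {N : ℕ} {ψ : Config N → Spinor N}
    (hcont : ContinuousOn ψ (closure (orderedConfigs N)))
    (hdiff : ContDiffOn ℝ 1 ψ (orderedConfigs N)) (hdirac : SolvesDirac ψ (orderedConfigs N))
    (hswap : SwapInvariant ψ) {s : Fin N → Fin 2} {x : Config N}
    (hx : x ∈ closure (orderedConfigs N)) {k : Fin (N - 1)} (hk : s (lo k) ≠ s (hi k)) :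
    ∃ y ∈ closure (orderedConfigs N), (∀ l, nullCoord (s l) (y (Equiv.swap (lo k) (hi k) l)) =
      nullCoord (s l) (x l)) ∧ ‖ψ y (s ∘ Equiv.swap (lo k) (hi k))‖ = ‖ψ x s‖ := by
  -- For both particles of the pair, null coordinate `e` is copied from whichever of them has spin
  -- `e`. Each `p e` is monotone, so the new configuration stays in the closure.
  let p : Fin 2 → Fin N → Fin N := fun e l =>
    if l = lo k ∨ l = hi k then (if s (lo k) = e then lo k else hi k) else l
  have hp : ∀ e, Monotone (p e) := by
    intro e
    refine monotone_of_lo_le_hi fun j => ?_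
    simp only [p, Fin.ext_iff, Fin.le_def, lo, hi]
    split_ifs <;> simp <;> omega
  have hps : ∀ l, p (s l) l = l := by
    intro l
    simp only [p]
    split_ifs with h1 h2
    · rcases h1 with rfl | rfl
      · rfl
      · exact absurd h2 hk
    · rcases h1 with rfl | rfl
      · exact absurd rfl h2
      · rfl
    · rfl
  set y : Config N := ofNull fun e l => nullCoord e (x (p e l)) with hy
  have hycl : y ∈ closure (orderedConfigs N) := by
    rw [mem_closure_orderedConfigs_iff] at hx ⊢
    intro e
    simp only [hy, nullCoord_ofNull]
    exact (hx e).comp (hp e)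
  have hyeq : y (lo k) = y (hi k) := by
    simp [hy, ofNull, p]
  refine ⟨y, hycl, fun l => ?_, ?_⟩
  · have hyl : y (Equiv.swap (lo k) (hi k) l) = y l := congrFun (comp_swap_eq_self hyeq) l
    rw [hyl, hy, nullCoord_ofNull, hps]
  · rw [hswap k y ⟨hycl, by rw [hyeq], by rw [hyeq]⟩]
    rw [eq_of_nullCoord_eq hcont hdiff hdirac hycl hx fun l => ?_]
    rw [hy, nullCoord_ofNull, hps]

/-- The absolute value of `ψ` at time zero, in the component and at the configuration obtained by
sorting the pairs of a position and a spin index. -/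
def sortedNorm {N : ℕ} (ψ : Config N → Spinor N) (f : Fin N → ℝ ×ₗ Fin 2) : ℝ :=
  ‖ψ (fun k => ![0, (ofLex (f (Tuple.sort f k))).1]) fun k => (ofLex (f (Tuple.sort f k))).2‖

theorem sortedNorm_comp_perm {N : ℕ} (ψ : Config N → Spinor N) (f : Fin N → ℝ ×ₗ Fin 2)
    (σ : Equiv.Perm (Fin N)) : sortedNorm ψ (f ∘ σ) = sortedNorm ψ f := by
  have h := congrFun (Tuple.comp_perm_comp_sort_eq_comp_sort (f := f) (σ := σ))
  simp only [Function.comp] at h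
  simp only [sortedNorm, Function.comp, h]

/-- Induction along the sort: at each stage some configuration of the closure carries the current
labels and has the same absolute value. -/
theorem norm_eq_sortedNorm {N : ℕ} {ψ : Config N → Spinor N}
    (hcont : ContinuousOn ψ (closure (orderedConfigs N)))
    (hdiff : ContDiffOn ℝ 1 ψ (orderedConfigs N)) (hdirac : SolvesDirac ψ (orderedConfigs N))
    (hswap : SwapInvariant ψ) (s : Fin N → Fin 2) {x : Config N}
    (hx : x ∈ closure (orderedConfigs N)) :
    ‖ψ x s‖ = sortedNorm ψ fun k => toLex (nullCoord (s k) (x k), s k) := by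
  set f : Fin N → ℝ ×ₗ Fin 2 := fun k => toLex (nullCoord (s k) (x k), s k) with hf
  obtain ⟨y, hy, hyf, hyn⟩ := adjacent_sort_induction f
    (fun g => ∃ y ∈ closure (orderedConfigs N),
      (∀ k, nullCoord (ofLex (g k)).2 (y k) = (ofLex (g k)).1) ∧
        ‖ψ y fun k => (ofLex (g k)).2‖ = ‖ψ x s‖) ⟨x, hx, fun k => rfl, rfl⟩ (by
      rintro g k ⟨y, hy, hyg, hyn⟩ hlt
      -- For equal spins the labels are already in order, since null coordinates are monotone on the
      -- closure; a descent therefore has opposite spins, as `exists_swap` requires.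
      have hne : (ofLex (g (lo k))).2 ≠ (ofLex (g (hi k))).2 := by
        intro he
        have hle : (ofLex (g (lo k))).1 ≤ (ofLex (g (hi k))).1 := by
          rw [← hyg, ← hyg, he]
          exact mem_closure_orderedConfigs_iff.mp hy _ (Fin.mk_le_mk.mpr (Nat.le_succ _))
        rcases Prod.Lex.lt_iff.mp hlt with h1 | ⟨-, h1⟩
        · exact absurd h1 (not_lt_of_ge hle)
        · exact absurd h1 (by rw [he]; exact lt_irrefl _)
      obtain ⟨w, hw, hwy, hwn⟩ := exists_swap hcont hdiff hdirac hswap hy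
        (s := fun k => (ofLex (g k)).2) hne
      refine ⟨w, hw, fun l => ?_, hwn.trans hyn⟩
      have := hwy (Equiv.swap (lo k) (hi k) l)
      rw [Equiv.swap_apply_self] at this
      rw [Function.comp, this, hyg])
  rw [← hyn, sortedNorm]
  congr 1
  -- At time zero both null coordinates equal the position, so the sorted positions form a
  -- configuration of the closure.
  refine eq_of_nullCoord_eq hcont hdiff hdirac hy ?_ fun k => ?_
  · rw [mem_closure_orderedConfigs_iff]
    intro e i j hij
    have := Prod.Lex.monotone_fst _ _ (Tuple.monotone_sort f hij)
    simpa [nullCoord] using this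
  · rw [hyf]
    simp [nullCoord]

/-! ### Space-like hypersurfaces in null coordinates -/

namespace SpacelikeHypersurface

variable (S : SpacelikeHypersurface)

/-- The null coordinate `z - ε(e) t` along the hypersurface. -/
def null (e : Fin 2) (z : ℝ) : ℝ := z - chi e * S.time z

/-- The derivative of `S.null e`. -/
def slope (e : Fin 2) (z : ℝ) : ℝ := 1 - chi e * deriv S.time z

theorem differentiable_time : Differentiable ℝ S.time :=
  S.smooth.differentiable (by simp)

theorem hasDerivAt_null (e : Fin 2) (z : ℝ) : HasDerivAt (S.null e) (S.slope e z) z :=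
  (hasDerivAt_id z).sub ((S.differentiable_time z).hasDerivAt.const_mul (chi e))

theorem slope_pos (e : Fin 2) (z : ℝ) : 0 < S.slope e z := by
  have := abs_lt.mp (S.spacelike z)
  fin_cases e <;> simp [slope] <;> linarith

theorem slope_le_two (e : Fin 2) (z : ℝ) : S.slope e z ≤ 2 := by
  have := abs_lt.mp (S.spacelike z)
  fin_cases e <;> simp [slope] <;> linarith

theorem continuous_slope (e : Fin 2) : Continuous (S.slope e) :=
  continuous_const.sub (continuous_const.mul (S.smooth.continuous_deriv (by simp)))

theorem continuous_null (e : Fin 2) : Continuous (S.null e) :=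
  continuous_iff_continuousAt.mpr fun z => (S.hasDerivAt_null e z).continuousAt

theorem strictMono_null (e : Fin 2) : StrictMono (S.null e) :=
  strictMono_of_deriv_pos fun z => by
    rw [(S.hasDerivAt_null e z).deriv]
    exact S.slope_pos e z

/-- The null coordinates `z_k - ε(s_k) t_k` as functions on `Σ^N`. -/
def nullMap {N : ℕ} (s : Fin N → Fin 2) (z : Fin N → ℝ) : Fin N → ℝ := fun k => S.null (s k) (z k)

theorem nullCoord_param {N : ℕ} (e : Fin 2) (z : Fin N → ℝ) (k : Fin N) :
    nullCoord e (S.param z k) = S.null e (z k) := by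
  simp [nullCoord, param, null]

/-- Both null coordinates increase strictly along a space-like hypersurface, so ordering alone makes
the configuration space-like. -/
theorem mem_domain_iff {N : ℕ} {z : Fin N → ℝ} : z ∈ S.domain N ↔ StrictMono z := by
  refine ⟨fun h => ?_, fun h => mem_orderedConfigs_iff.mpr fun e => ?_⟩
  · simpa [param] using h.2
  · simp only [nullCoord_param]
    exact (S.strictMono_null e).comp h

theorem param_mem_closure {N : ℕ} {z : Fin N → ℝ} (hz : Monotone z) :
    S.param z ∈ closure (orderedConfigs N) := by
  rw [mem_closure_orderedConfigs_iff]
  intro e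
  simp only [nullCoord_param]
  exact (S.strictMono_null e).monotone.comp hz

theorem param_mem_power {N : ℕ} (z : Fin N → ℝ) : S.param z ∈ S.power N := fun k => by
  simp [param]

theorem continuous_param {N : ℕ} : Continuous (S.param (N := N)) := by
  have := S.differentiable_time.continuous
  refine continuous_pi fun k => continuous_pi fun m => ?_
  fin_cases m <;> simp [param] <;> fun_prop

theorem fderiv_param_apply {N : ℕ} (z w : Fin N → ℝ) (k : Fin N) :
    fderiv ℝ (S.param (N := N)) z w k = ![deriv S.time (z k) * w k, w k] := by
  have h : HasFDerivAt (S.param (N := N)) (ContinuousLinearMap.pi fun k =>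
      ContinuousLinearMap.pi ![deriv S.time (z k) •
        (ContinuousLinearMap.proj k : (Fin N → ℝ) →L[ℝ] ℝ), ContinuousLinearMap.proj k]) z := by
    refine hasFDerivAt_pi.mpr fun k => hasFDerivAt_pi.mpr fun m => ?_
    have hk : HasFDerivAt (fun z : Fin N → ℝ => z k)
        (ContinuousLinearMap.proj k : (Fin N → ℝ) →L[ℝ] ℝ) z := hasFDerivAt_apply k z
    fin_cases m
    · exact (S.differentiable_time (z k)).hasDerivAt.comp_hasFDerivAt z hk
    · exact hk
  rw [h.fderiv]
  funext m
  fin_cases m <;> simp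

/-- The `k`-th tangent vector moves only particle `k`, so the matrix is diagonal. The product of
slopes is the Jacobian of `nullMap s`. -/
theorem pullback_currentForm {N : ℕ} (ψ : Config N → Spinor N) (z : Fin N → ℝ) :
    S.pullback (currentForm ψ) z =
      ∑ s, ‖ψ (S.param z) s‖ ^ 2 * ∏ k, S.slope (s k) (z k) := by
  rw [pullback, currentForm_apply]
  refine Finset.sum_congr rfl fun s _ => ?_
  congr 1
  rw [← Matrix.det_diagonal]
  congr 1
  ext i k
  simp only [nullMatrix, nullCoord, Matrix.of_apply, fderiv_param_apply, Matrix.diagonal_apply]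
  rcases eq_or_ne i k with rfl | h
  · simp [slope]
  · simp [h, h.symm]

theorem measurableSet_domain (N : ℕ) : MeasurableSet (S.domain N) :=
  ((isOpen_orderedConfigs N).preimage S.continuous_param).measurableSet

theorem continuousOn_component {N : ℕ} {ψ : Config N → Spinor N}
    (hcont : ContinuousOn ψ (closure (orderedConfigs N))) (s : Fin N → Fin 2) :
    ContinuousOn (fun z => ‖ψ (S.param z) s‖ ^ 2 * ∏ k, S.slope (s k) (z k)) (S.domain N) := by
  have h1 : ContinuousOn (fun z => ψ (S.param z)) (S.domain N) :=
    hcont.comp S.continuous_param.continuousOn fun z hz => subset_closure hz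
  have h2 : Continuous fun z : Fin N → ℝ => ∏ k, S.slope (s k) (z k) :=
    continuous_finsetProd _ fun k _ => (S.continuous_slope (s k)).comp (continuous_apply k)
  exact (((continuousOn_pi.mp h1 s).norm).pow 2).mul h2.continuousOn

theorem component_nonneg {N : ℕ} (ψ : Config N → Spinor N) (s : Fin N → Fin 2)
    (z : Fin N → ℝ) : 0 ≤ ‖ψ (S.param z) s‖ ^ 2 * ∏ k, S.slope (s k) (z k) :=
  mul_nonneg (by positivity) (Finset.prod_nonneg fun k _ => (S.slope_pos _ _).le)

theorem pullback_nonneg {N : ℕ} (ψ : Config N → Spinor N) (z : Fin N → ℝ) :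
    0 ≤ S.pullback (currentForm ψ) z := by
  rw [pullback_currentForm]
  exact Finset.sum_nonneg fun s _ => S.component_nonneg ψ s z

theorem continuousOn_pullback {N : ℕ} {ψ : Config N → Spinor N}
    (hcont : ContinuousOn ψ (closure (orderedConfigs N))) :
    ContinuousOn (S.pullback (currentForm ψ)) (S.domain N) := by
  have : S.pullback (currentForm ψ) = fun z =>
      ∑ s, ‖ψ (S.param z) s‖ ^ 2 * ∏ k, S.slope (s k) (z k) :=
    funext fun z => S.pullback_currentForm ψ z
  rw [this]
  exact continuousOn_finsetSum _ fun s _ => S.continuousOn_component hcont s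

/-! ### Integrability of the probability density -/

theorem integrableOn_pullback {N : ℕ} {ψ : Config N → Spinor N} {A : Set (Config N)}
    (hcont : ContinuousOn ψ (closure (orderedConfigs N)))
    (hSA : S.power N ∩ orderedConfigs N ⊆ A) (hA : A ⊆ closure (orderedConfigs N))
    (hcpt : CompactlySupportedOn ψ A) :
    IntegrableOn (S.pullback (currentForm ψ)) (S.domain N) := by
  set K := closure {x | x ∈ A ∧ ψ x ≠ 0} with hK
  have hKcl : K ⊆ closure (orderedConfigs N) :=
    closure_minimal (fun x hx => hA hx.1) isClosed_closure
  obtain ⟨C, hC⟩ := hcpt.exists_bound_of_continuousOn (hcont.mono hKcl)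
  obtain ⟨R, hR⟩ := hcpt.isBounded.exists_norm_le
  have hmem : ∀ z ∈ S.domain N, ψ (S.param z) ≠ 0 → S.param z ∈ K := fun z hz h =>
    subset_closure ⟨hSA ⟨S.param_mem_power z, hz⟩, h⟩
  have hsmall : IntegrableOn (S.pullback (currentForm ψ))
      -- The maximum with `0` is needed because `R` may be negative when the support is empty.
      (S.domain N ∩ Metric.closedBall 0 (max R 0)) := by
    have hm : MeasurableSet (S.domain N ∩ Metric.closedBall 0 (max R 0)) :=
      (S.measurableSet_domain N).inter Metric.isClosed_closedBall.measurableSet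
    refine IntegrableOn.of_bound (C := ∑ s : Fin N → Fin 2, C ^ 2 * 2 ^ N)
      ((measure_mono Set.inter_subset_right).trans_lt measure_closedBall_lt_top)
      (((S.continuousOn_pullback hcont).mono Set.inter_subset_left).aestronglyMeasurable hm) ?_
    refine (ae_restrict_iff' hm).mpr (Eventually.of_forall fun z hz => ?_)
    rw [Real.norm_of_nonneg (S.pullback_nonneg ψ z), pullback_currentForm]
    refine Finset.sum_le_sum fun s _ => ?_
    have h1 : ‖ψ (S.param z) s‖ ^ 2 ≤ C ^ 2 := by
      by_cases h0 : ψ (S.param z) = 0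
      · rw [h0]
        simpa using sq_nonneg C
      · have h2 := hC _ (hmem z hz.1 h0)
        have h3 := norm_le_pi_norm (ψ (S.param z)) s
        exact pow_le_pow_left₀ (norm_nonneg _) (h3.trans h2) 2
    have h2 : ∏ k, S.slope (s k) (z k) ≤ 2 ^ N := by
      simpa using Finset.prod_le_prod (s := Finset.univ) (f := fun k => S.slope (s k) (z k))
        (g := fun _ => 2) (fun k _ => (S.slope_pos _ _).le) fun k _ => S.slope_le_two _ _
    exact mul_le_mul h1 h2 (Finset.prod_nonneg fun k _ => (S.slope_pos _ _).le) (sq_nonneg C)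
  refine hsmall.of_forall_sdiff_eq_zero (S.measurableSet_domain N) fun z hz => ?_
  have h0 : ψ (S.param z) = 0 := by
    by_contra h
    refine hz.2 ⟨hz.1, ?_⟩
    have h1 := hR _ (hmem z hz.1 h)
    rw [mem_closedBall_zero_iff, pi_norm_le_iff_of_nonneg (le_max_right _ _)]
    intro k
    have h2 := (norm_le_pi_norm (S.param z k) 1).trans ((norm_le_pi_norm (S.param z) k).trans h1)
    exact le_max_of_le_left (by simpa [param] using h2)
  rw [pullback_currentForm, h0]
  simp

/-! ### The probability as an integral over null coordinates -/

theorem hasFDerivAt_nullMap {N : ℕ} (s : Fin N → Fin 2) (z : Fin N → ℝ) :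
    HasFDerivAt (S.nullMap s) (ContinuousLinearMap.pi fun k =>
      (S.slope (s k) (z k) • ContinuousLinearMap.id ℝ ℝ) ∘SL ContinuousLinearMap.proj k) z := by
  refine hasFDerivAt_pi.mpr fun k => ?_
  have hk : HasFDerivAt (fun z : Fin N → ℝ => z k)
      (ContinuousLinearMap.proj k : (Fin N → ℝ) →L[ℝ] ℝ) z := hasFDerivAt_apply k z
  have := (S.hasDerivAt_null (s k) (z k)).hasFDerivAt.comp z hk
  refine this.congr_fderiv ?_
  ext
  simp [mul_comm]

theorem injective_nullMap {N : ℕ} (s : Fin N → Fin 2) : Function.Injective (S.nullMap s) :=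
  fun _ _ h => funext fun k => (S.strictMono_null (s k)).injective (congrFun h k)

end SpacelikeHypersurface

/-- The square of `sortedNorm`, as a function of the spin indices and the positions. -/
def sortedDensity {N : ℕ} (ψ : Config N → Spinor N) (s : Fin N → Fin 2) (u : Fin N → ℝ) : ℝ :=
  sortedNorm ψ (fun k => toLex (u k, s k)) ^ 2

theorem sortedDensity_comp_perm {N : ℕ} (ψ : Config N → Spinor N) (s : Fin N → Fin 2)
    (u : Fin N → ℝ) (σ : Equiv.Perm (Fin N)) :
    sortedDensity ψ (s ∘ σ) (u ∘ σ) = sortedDensity ψ s u := by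
  rw [sortedDensity, sortedDensity, ← sortedNorm_comp_perm ψ (fun k => toLex (u k, s k)) σ]
  rfl

theorem volume_not_injective (N : ℕ) :
    volume {z : Fin N → ℝ | ¬Function.Injective z} = 0 := by
  have hsub : {z : Fin N → ℝ | ¬Function.Injective z} ⊆
      ⋃ (i : Fin N) (j : Fin N) (_ : i ≠ j), {z | z i = z j} := by
    intro z hz
    simp only [Function.Injective, not_forall, Set.mem_ofPred_eq] at hz
    obtain ⟨i, j, h, hij⟩ := hz
    simp only [Set.mem_iUnion]
    exact ⟨i, j, hij, h⟩
  refine measure_mono_null hsub ?_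
  simp only [measure_iUnion_null_iff]
  intro i j hij
  let L : (Fin N → ℝ) →ₗ[ℝ] ℝ := (LinearMap.proj i : (Fin N → ℝ) →ₗ[ℝ] ℝ) - LinearMap.proj j
  have hL : {z : Fin N → ℝ | z i = z j} = (L.ker : Set (Fin N → ℝ)) := by
    ext z
    simp [L, sub_eq_zero]
  rw [hL]
  refine Measure.addHaar_submodule _ _ fun htop => ?_
  have : Pi.single i 1 ∈ L.ker := by rw [htop]; trivial
  simp [L, hij.symm] at this

theorem lintegral_comp_perm {N : ℕ} (f : (Fin N → ℝ) → ENNReal) (A : Set (Fin N → ℝ))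
    (σ : Equiv.Perm (Fin N)) :
    ∫⁻ z in {z | z ∘ σ ∈ A}, f (z ∘ σ) = ∫⁻ z in A, f z := by
  have h := (volume_measurePreserving_piCongrLeft (fun _ : Fin N => ℝ)
    σ.symm).setLIntegral_comp_preimage_emb (MeasurableEquiv.measurableEmbedding _) f A
  have he : (MeasurableEquiv.piCongrLeft (fun _ : Fin N => ℝ) σ.symm : (Fin N → ℝ) → _) =
      fun z => z ∘ σ := by
    funext z k
    simp [MeasurableEquiv.coe_piCongrLeft, Equiv.piCongrLeft_apply]
  rw [he] at h
  exact h

/-- The `N!` strict orderings of the coordinates partition `ℝ^N` up to the null set where two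
coordinates agree. -/
theorem sum_lintegral_strictMono_comp {N : ℕ} (f : (Fin N → ℝ) → ENNReal) :
    ∑ σ : Equiv.Perm (Fin N), ∫⁻ z in {z | StrictMono (z ∘ σ)}, f z = ∫⁻ z, f z := by
  have hmeas : ∀ σ : Equiv.Perm (Fin N), MeasurableSet {z : Fin N → ℝ | StrictMono (z ∘ σ)} := by
    intro σ
    have : {z : Fin N → ℝ | StrictMono (z ∘ σ)} =
        ⋂ (i : Fin N) (j : Fin N) (_ : i < j), {z | z (σ i) < z (σ j)} := by
      ext z
      simp [StrictMono]
    rw [this]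
    exact MeasurableSet.iInter fun i => MeasurableSet.iInter fun j => MeasurableSet.iInter fun _ =>
      measurableSet_lt (measurable_pi_apply _) (measurable_pi_apply _)
  have hdisj : Pairwise (Function.onFun Disjoint
      fun σ : Equiv.Perm (Fin N) => {z : Fin N → ℝ | StrictMono (z ∘ σ)}) := by
    intro σ τ hne
    refine Set.disjoint_left.mpr fun z (hσ : StrictMono (z ∘ σ)) (hτ : StrictMono (z ∘ τ)) => ?_
    have hz : Function.Injective z := (Function.Injective.of_comp_iff' z σ.bijective).mp hσ.injective
    have := Tuple.unique_monotone hσ.monotone hτ.monotone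
    exact hne (Equiv.ext fun k => hz (congrFun this k))
  rw [← tsum_fintype (L := .unconditional _), ← lintegral_iUnion hmeas hdisj, ← setLIntegral_univ (μ := volume) f]
  refine setLIntegral_congr ?_
  rw [eventuallyEq_univ, mem_ae_iff]
  refine measure_mono_null (fun z hz => ?_) (volume_not_injective N)
  intro hinj
  refine hz (Set.mem_iUnion.mpr ⟨Tuple.sort z, ?_⟩)
  exact (Tuple.monotone_sort z).strictMono_of_injective (hinj.comp (Tuple.sort z).injective)

/-- The integral of `sortedDensity` over the null coordinates reached by `Σ^N`. -/
def SpacelikeHypersurface.total (S : SpacelikeHypersurface) {N : ℕ} (ψ : Config N → Spinor N) :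
    ENNReal :=
  ∑ s : Fin N → Fin 2, ∫⁻ u in Set.range (S.nullMap s), ENNReal.ofReal (sortedDensity ψ s u)

theorem SpacelikeHypersurface.factorial_mul_lintegral (S : SpacelikeHypersurface) {N : ℕ}
    {ψ : Config N → Spinor N} (hcont : ContinuousOn ψ (closure (orderedConfigs N)))
    (hdiff : ContDiffOn ℝ 1 ψ (orderedConfigs N)) (hdirac : SolvesDirac ψ (orderedConfigs N))
    (hswap : SwapInvariant ψ) :
    N.factorial * ∫⁻ z in S.domain N, ENNReal.ofReal (S.pullback (currentForm ψ) z) =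
      S.total ψ := by
  -- This extends the integrand of component `s` from ordered `z` to all of `ℝ^N`, invariantly under
  -- simultaneous permutation of `s` and `z`.
  let h : (Fin N → Fin 2) → (Fin N → ℝ) → ENNReal := fun s z =>
    ENNReal.ofReal (∏ k, S.slope (s k) (z k)) * ENNReal.ofReal (sortedDensity ψ s (S.nullMap s z))
  have hperm : ∀ s z (σ : Equiv.Perm (Fin N)), h (s ∘ σ) (z ∘ σ) = h s z := by
    intro s z σ
    have h1 : S.nullMap (s ∘ σ) (z ∘ σ) = S.nullMap s z ∘ σ := rfl
    simp only [h, h1, sortedDensity_comp_perm, Function.comp]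
    rw [Equiv.prod_comp σ fun k => S.slope (s k) (z k)]
  have hdom : S.domain N = {z | StrictMono z} := Set.ext fun z => S.mem_domain_iff
  have hcomp : ∀ s, ∀ z ∈ S.domain N,
      ENNReal.ofReal (‖ψ (S.param z) s‖ ^ 2 * ∏ k, S.slope (s k) (z k)) = h s z := by
    intro s z hz
    rw [norm_eq_sortedNorm hcont hdiff hdirac hswap s (subset_closure hz), mul_comm,
      ENNReal.ofReal_mul (Finset.prod_nonneg fun k _ => (S.slope_pos _ _).le)]
    simp only [nullCoord_param]
    rfl
  have hsum : ∫⁻ z in S.domain N, ENNReal.ofReal (S.pullback (currentForm ψ) z) =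
      ∑ s, ∫⁻ z in S.domain N, h s z := by
    simp only [pullback_currentForm]
    simp_rw [ENNReal.ofReal_sum_of_nonneg fun s _ => S.component_nonneg ψ s _]
    rw [lintegral_finsetSum']
    · exact Finset.sum_congr rfl fun s _ =>
        setLIntegral_congr_fun (S.measurableSet_domain N) (hcomp s)
    · exact fun s _ => ((S.continuousOn_component hcont s).aemeasurable
        (S.measurableSet_domain N)).ennreal_ofReal
  -- After summation over all `s`, each of the `N!` chambers contributes the same amount.
  have hreindex : ∀ σ : Equiv.Perm (Fin N), ∑ s, ∫⁻ z in S.domain N, h s z =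
      ∑ s, ∫⁻ z in {z | StrictMono (z ∘ σ)}, h s z := by
    intro σ
    rw [← (Equiv.arrowCongr σ.symm (Equiv.refl (Fin 2))).sum_comp]
    refine Finset.sum_congr rfl fun s _ => ?_
    have h1 : Equiv.arrowCongr σ.symm (Equiv.refl (Fin 2)) s = s ∘ σ := by
      funext l; simp [Equiv.arrowCongr]
    rw [h1, ← lintegral_comp_perm _ _ σ, hdom]
    simp only [hperm]
    rfl
  have hcard : (N.factorial : ENNReal) = ∑ _σ : Equiv.Perm (Fin N), 1 := by
    simp [Fintype.card_perm]
  rw [hsum, hcard, Finset.sum_mul, total]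
  simp only [one_mul]
  rw [Finset.sum_congr rfl fun σ _ => hreindex σ, Finset.sum_comm]
  refine Finset.sum_congr rfl fun s _ => ?_
  -- The chambers are glued to `ℝ^N`, and the substitution `u = nullMap s z` absorbs the slopes.
  rw [sum_lintegral_strictMono_comp, ← Set.image_univ,
    lintegral_image_eq_lintegral_abs_det_fderiv_mul volume MeasurableSet.univ
      (fun z _ => (S.hasFDerivAt_nullMap s z).hasFDerivWithinAt) (S.injective_nullMap s).injOn,
    setLIntegral_univ]
  refine lintegral_congr fun z => ?_
  have hdet : ∀ c : ℝ, (c • ContinuousLinearMap.id ℝ ℝ).det = c := by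
    intro c
    simp [ContinuousLinearMap.det, LinearMap.det_ring]
  rw [ContinuousLinearMap.det_pi]
  simp only [hdet]
  rw [abs_of_nonneg (Finset.prod_nonneg fun k _ => (S.slope_pos _ _).le)]

theorem probabilityConserved_of_total_eq {N : ℕ} {ψ : Config N → Spinor N}
    (hcont : ContinuousOn ψ (closure (orderedConfigs N)))
    (hdiff : ContDiffOn ℝ 1 ψ (orderedConfigs N)) (hdirac : SolvesDirac ψ (orderedConfigs N))
    (hswap : SwapInvariant ψ) {S S' : SpacelikeHypersurface}
    (hS : IntegrableOn (S.pullback (currentForm ψ)) (S.domain N))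
    (hS' : IntegrableOn (S'.pullback (currentForm ψ)) (S'.domain N))
    (htotal : S.total ψ = S'.total ψ) : ProbabilityConserved ψ S S' := by
  refine ⟨hS, hS', ?_⟩
  rw [SpacelikeHypersurface.integral, SpacelikeHypersurface.integral,
    integral_eq_lintegral_of_nonneg_ae (Eventually.of_forall (S.pullback_nonneg ψ))
      hS.aestronglyMeasurable,
    integral_eq_lintegral_of_nonneg_ae (Eventually.of_forall (S'.pullback_nonneg ψ))
      hS'.aestronglyMeasurable]
  rw [← S.factorial_mul_lintegral hcont hdiff hdirac hswap,
    ← S'.factorial_mul_lintegral hcont hdiff hdirac hswap] at htotal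
  congr 1
  exact (ENNReal.mul_right_inj (by exact_mod_cast N.factorial_ne_zero)
    (ENNReal.natCast_ne_top _)).mp htotal

/-! ### Cauchy surfaces -/

/-- Meeting every light-like line says exactly that both null coordinates are surjective along the
surface. -/
theorem SpacelikeHypersurface.IsCauchy.range_nullMap {S : SpacelikeHypersurface} (hS : S.IsCauchy)
    {N : ℕ} (s : Fin N → Fin 2) : Set.range (S.nullMap s) = Set.univ := by
  have hsurj : ∀ e c, ∃ z, S.null e z = c := by
    intro e c
    fin_cases e
    · simpa [null] using (hS c).2
    · simpa [null] using (hS c).1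
  refine Set.eq_univ_of_forall fun u => ?_
  choose z hz using fun k => hsurj (s k) (u k)
  exact ⟨z, funext hz⟩

theorem probabilityConserved_of_isCauchy {N : ℕ} {ψ : Config N → Spinor N}
    (hcont : ContinuousOn ψ (closure (orderedConfigs N)))
    (hdiff : ContDiffOn ℝ 1 ψ (orderedConfigs N)) (hdirac : SolvesDirac ψ (orderedConfigs N))
    (hswap : SwapInvariant ψ)
    (hcpt : ∀ S : SpacelikeHypersurface, S.IsCauchy →
      CompactlySupportedOn ψ (S.power N ∩ orderedConfigs N))
    (S S' : SpacelikeHypersurface) (hS : S.IsCauchy) (hS' : S'.IsCauchy) :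
    ProbabilityConserved ψ S S' := by
  have hint : ∀ T : SpacelikeHypersurface, T.IsCauchy →
      IntegrableOn (T.pullback (currentForm ψ)) (T.domain N) := fun T hT =>
    T.integrableOn_pullback hcont subset_rfl (Set.inter_subset_right.trans subset_closure)
      (hcpt T hT)
  refine probabilityConserved_of_total_eq hcont hdiff hdirac hswap (hint S hS) (hint S' hS') ?_
  simp only [SpacelikeHypersurface.total, hS.range_nullMap, hS'.range_nullMap]

/-! ### Hypersurfaces that need not be Cauchy -/

/-- The interpolating hypersurface between `S` and `S'`. -/
def interpolate (S S' : SpacelikeHypersurface) (τ : ℝ) (hτ : τ ∈ Set.Icc (0 : ℝ) 1) :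
    SpacelikeHypersurface where
  time z := S.time z + τ * (S'.time z - S.time z)
  smooth := S.smooth.add (contDiff_const.mul (S'.smooth.sub S.smooth))
  spacelike z := by
    have h : HasDerivAt (fun z => S.time z + τ * (S'.time z - S.time z))
        (deriv S.time z + τ * (deriv S'.time z - deriv S.time z)) z :=
      (S.differentiable_time z).hasDerivAt.add
        (((S'.differentiable_time z).hasDerivAt.sub
          (S.differentiable_time z).hasDerivAt).const_mul τ)
    rw [h.deriv]
    have h1 := abs_lt.mp (S.spacelike z)
    have h2 := abs_lt.mp (S'.spacelike z)
    obtain ⟨h0, h3⟩ := hτ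
    rw [abs_lt]
    rcases h0.eq_or_lt with rfl | h0'
    · simpa using h1
    · constructor <;> nlinarith

theorem sweptRegion_comm (N : ℕ) (S S' : SpacelikeHypersurface) :
    sweptRegion N S S' = sweptRegion N S' S := by
  have h : ∀ S S' : SpacelikeHypersurface, sweptRegion N S S' ⊆ sweptRegion N S' S := by
    rintro S S' x ⟨hx, τ, hτ, h⟩
    refine ⟨hx, 1 - τ, ⟨by linarith [hτ.2], by linarith [hτ.1]⟩, fun k => ?_⟩
    rw [h k]
    ring
  exact (h S S').antisymm (h S' S)

theorem power_inter_subset_sweptRegion (N : ℕ) (S S' : SpacelikeHypersurface) :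
    S.power N ∩ orderedConfigs N ⊆ sweptRegion N S S' := by
  rintro x ⟨hx, hx'⟩
  exact ⟨subset_closure hx', 0, by simp, fun k => by simpa using hx k⟩

/-- Continuous induction on the deformation parameter: the set of `τ` whose interpolating surface
reaches `u` contains `0`, is closed, and is open to the right. -/
theorem mem_range_nullMap_of_sortedDensity_ne_zero {N : ℕ} {ψ : Config N → Spinor N}
    (hcont : ContinuousOn ψ (closure (orderedConfigs N)))
    (hdiff : ContDiffOn ℝ 1 ψ (orderedConfigs N)) (hdirac : SolvesDirac ψ (orderedConfigs N))
    (hswap : SwapInvariant ψ) {S S' : SpacelikeHypersurface}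
    (hcpt : CompactlySupportedOn ψ (sweptRegion N S S')) {s : Fin N → Fin 2} {u : Fin N → ℝ}
    (hu : u ∈ Set.range (S.nullMap s)) (hne : sortedDensity ψ s u ≠ 0) :
    u ∈ Set.range (S'.nullMap s) := by
  obtain ⟨R, hR⟩ := hcpt.isBounded.exists_norm_le
  let Φ : ℝ → Fin 2 → ℝ → ℝ := fun τ e z => z - chi e * (S.time z + τ * (S'.time z - S.time z))
  -- Any `z` realising `u` at stage `τ`, once sorted, gives a point of the swept region where some
  -- component of `ψ` has square modulus equal to the density at `u`, hence is nonzero. This point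
  -- lies in the compact support, which bounds `z` uniformly in `τ`.
  have hbound : ∀ τ ∈ Set.Icc (0 : ℝ) 1, ∀ z : Fin N → ℝ, (∀ k, Φ τ (s k) (z k) = u k) →
      ∀ k, z k ∈ Set.Icc (-R) R := by
    intro τ hτ z hz k
    set T := interpolate S S' τ hτ with hT
    have hcl := T.param_mem_closure (Tuple.monotone_sort z)
    have hnorm := norm_eq_sortedNorm hcont hdiff hdirac hswap (s ∘ Tuple.sort z) hcl
    have hf : (fun k => toLex (nullCoord ((s ∘ Tuple.sort z) k) (T.param (z ∘ Tuple.sort z) k),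
        (s ∘ Tuple.sort z) k)) = (fun k => toLex (u k, s k)) ∘ Tuple.sort z := by
      funext l
      simp only [SpacelikeHypersurface.nullCoord_param, Function.comp, ← hz]
      rfl
    rw [hf, sortedNorm_comp_perm] at hnorm
    have hψ : ψ (T.param (z ∘ Tuple.sort z)) ≠ 0 := by
      intro h0
      rw [h0] at hnorm
      simp only [Pi.zero_apply, norm_zero] at hnorm
      exact hne (by rw [sortedDensity, ← hnorm]; simp)
    have hmem : T.param (z ∘ Tuple.sort z) ∈ closure {x | x ∈ sweptRegion N S S' ∧ ψ x ≠ 0} :=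
      subset_closure ⟨⟨hcl, τ, hτ, fun l => T.param_mem_power _ l⟩, hψ⟩
    have h1 := (norm_le_pi_norm (T.param (z ∘ Tuple.sort z) ((Tuple.sort z).symm k)) 1).trans
      ((norm_le_pi_norm _ _).trans (hR _ hmem))
    simpa [SpacelikeHypersurface.param, abs_le] using h1
  have hΦ : ∀ e, Continuous fun p : ℝ × ℝ => Φ p.1 e p.2 := by
    intro e
    have := S.differentiable_time.continuous
    have := S'.differentiable_time.continuous
    simp only [Φ]
    fun_prop
  let A : Set ℝ := {τ | ∃ z : Fin N → ℝ, (∀ k, z k ∈ Set.Icc (-R) R) ∧ ∀ k, Φ τ (s k) (z k) = u k}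
  -- With `z` confined to a cube, this is the projection of a compact set.
  have hclosed : IsClosed (A ∩ Set.Icc 0 1) := by
    have hA : A ∩ Set.Icc 0 1 = Prod.fst '' ((Set.Icc (0 : ℝ) 1 ×ˢ
        Set.univ.pi fun _ : Fin N => Set.Icc (-R) R) ∩ {p | ∀ k, Φ p.1 (s k) (p.2 k) = u k}) := by
      ext τ
      constructor
      · rintro ⟨⟨z, hz, hzu⟩, hτ⟩
        exact ⟨(τ, z), ⟨⟨hτ, fun k _ => hz k⟩, hzu⟩, rfl⟩
      · rintro ⟨⟨τ, z⟩, ⟨⟨hτ, hz⟩, hzu⟩, rfl⟩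
        exact ⟨⟨z, fun k => hz k trivial, hzu⟩, hτ⟩
    rw [hA]
    refine (((isCompact_Icc.prod (isCompact_univ_pi fun _ => isCompact_Icc)).inter_right ?_).image
      continuous_fst).isClosed
    simp only [Set.ofPred_forall]
    refine isClosed_iInter fun k => isClosed_eq ?_ continuous_const
    exact (hΦ (s k)).comp (continuous_fst.prodMk ((continuous_apply k).comp continuous_snd))
  have h0 : (0 : ℝ) ∈ A := by
    obtain ⟨z, rfl⟩ := hu
    have hz : ∀ k, Φ 0 (s k) (z k) = S.nullMap s z k := fun k => by
      simp [Φ, SpacelikeHypersurface.nullMap, SpacelikeHypersurface.null]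
    exact ⟨z, hbound 0 (by simp) z hz, hz⟩
  -- By strict monotonicity `u_k` lies strictly between the values at `z_k - 1` and `z_k + 1`. This
  -- persists for nearby `τ'`, and the intermediate value theorem supplies a new preimage.
  have hopen : ∀ τ ∈ A ∩ Set.Ico 0 1, A ∈ 𝓝[>] τ := by
    rintro τ ⟨⟨z, -, hz⟩, hτ⟩
    have hτ' : τ ∈ Set.Icc (0 : ℝ) 1 := ⟨hτ.1, hτ.2.le⟩
    have hnear : ∀ᶠ τ' in 𝓝 τ, ∀ k,
        Φ τ' (s k) (z k - 1) < u k ∧ u k < Φ τ' (s k) (z k + 1) := by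
      refine eventually_all.mpr fun k => ?_
      have hmono := (interpolate S S' τ hτ').strictMono_null (s k)
      have hc : ∀ w, Continuous fun τ' => Φ τ' (s k) w := fun w =>
        (hΦ (s k)).comp (continuous_id.prodMk continuous_const)
      have h1 : Φ τ (s k) (z k - 1) < u k := by
        rw [← hz k]; exact hmono (by linarith)
      have h2 : u k < Φ τ (s k) (z k + 1) := by
        rw [← hz k]; exact hmono (by linarith)
      exact ((hc _).continuousAt.eventually_lt continuousAt_const h1).and
        (continuousAt_const.eventually_lt (hc _).continuousAt h2)
    filter_upwards [nhdsWithin_le_nhds hnear, Ioo_mem_nhdsGT hτ.2] with τ' hτ1 hτ2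
    have hτ3 : τ' ∈ Set.Icc (0 : ℝ) 1 := ⟨hτ.1.trans hτ2.1.le, hτ2.2.le⟩
    have hex : ∀ k, ∃ w, Φ τ' (s k) w = u k := fun k => by
      obtain ⟨w, -, hw⟩ := intermediate_value_Icc (show z k - 1 ≤ z k + 1 by linarith)
        (((interpolate S S' τ' hτ3).continuous_null (s k)).continuousOn)
        ⟨(hτ1 k).1.le, (hτ1 k).2.le⟩
      exact ⟨w, hw⟩
    choose w hw using hex
    exact ⟨w, hbound τ' hτ3 w hw, hw⟩
  obtain ⟨z, -, hz⟩ := hclosed.Icc_subset_of_forall_mem_nhdsWithin h0 hopen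
    (show (1 : ℝ) ∈ Set.Icc 0 1 by simp)
  refine ⟨z, funext fun k => ?_⟩
  rw [← hz k]
  simp [Φ, SpacelikeHypersurface.nullMap, SpacelikeHypersurface.null]

/-- The ranges of the two null maps may differ, but only where the density vanishes; the two
integrands, extended by zero, therefore coincide. -/
theorem probabilityConserved_of_sweptRegion {N : ℕ} {ψ : Config N → Spinor N}
    (hcont : ContinuousOn ψ (closure (orderedConfigs N)))
    (hdiff : ContDiffOn ℝ 1 ψ (orderedConfigs N)) (hdirac : SolvesDirac ψ (orderedConfigs N))
    (hswap : SwapInvariant ψ) (S S' : SpacelikeHypersurface)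
    (hcpt : CompactlySupportedOn ψ (sweptRegion N S S')) : ProbabilityConserved ψ S S' := by
  have hcpt' : CompactlySupportedOn ψ (sweptRegion N S' S) := by
    rwa [sweptRegion_comm]
  refine probabilityConserved_of_total_eq hcont hdiff hdirac hswap
    (S.integrableOn_pullback hcont (power_inter_subset_sweptRegion N S S') (fun x hx => hx.1) hcpt)
    (S'.integrableOn_pullback hcont (power_inter_subset_sweptRegion N S' S) (fun x hx => hx.1)
      hcpt') ?_
  refine Finset.sum_congr rfl fun s _ => ?_
  have hmeas : ∀ T : SpacelikeHypersurface, MeasurableSet (Set.range (T.nullMap s)) := fun T => by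
    have hc : Continuous (T.nullMap s) :=
      continuous_pi fun k => (T.continuous_null (s k)).comp (continuous_apply k)
    exact (hc.measurableEmbedding (T.injective_nullMap s)).measurableSet_range
  rw [← lintegral_indicator (hmeas S), ← lintegral_indicator (hmeas S')]
  refine lintegral_congr fun u => ?_
  by_cases h : sortedDensity ψ s u = 0
  · simp [Set.indicator, h]
  · have hiff : u ∈ Set.range (S.nullMap s) ↔ u ∈ Set.range (S'.nullMap s) :=
      ⟨fun hu => mem_range_nullMap_of_sortedDensity_ne_zero hcont hdiff hdirac hswap hcpt hu h,
        fun hu => mem_range_nullMap_of_sortedDensity_ne_zero hcont hdiff hdirac hswap hcpt' hu h⟩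
    classical
    rw [Set.indicator_apply, Set.indicator_apply, if_congr hiff rfl rfl]

end MultiTime

end

theorem mainTheorem3 (N : ℕ) (ψ : MultiTime.Config N → MultiTime.Spinor N)
    (hcont : ContinuousOn ψ (closure (MultiTime.orderedConfigs N)))
    (hdiff : ContDiffOn ℝ 1 ψ (MultiTime.orderedConfigs N))
    (hdirac : MultiTime.SolvesDirac ψ (MultiTime.orderedConfigs N)) :
    -- vanishing of the current form on the coincidence set implies probability conservation
    (MultiTime.CurrentFormVanishes ψ →
      ((∀ S : MultiTime.SpacelikeHypersurface, S.IsCauchy →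
          MultiTime.CompactlySupportedOn ψ (S.power N ∩ MultiTime.orderedConfigs N)) →
        ∀ S S' : MultiTime.SpacelikeHypersurface, S.IsCauchy → S'.IsCauchy →
          MultiTime.ProbabilityConserved ψ S S') ∧
      (∀ S S' : MultiTime.SpacelikeHypersurface,
        MultiTime.CompactlySupportedOn ψ (MultiTime.sweptRegion N S S') →
          MultiTime.ProbabilityConserved ψ S S')) ∧
    -- the phase boundary conditions imply both
    (∀ φ : Fin (N - 1) → ℝ, (∀ k, φ k ∈ Set.Ioc (-Real.pi) Real.pi) →
      MultiTime.PhaseBoundaryConditions φ ψ →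
        MultiTime.CurrentFormVanishes ψ ∧
        ((∀ S : MultiTime.SpacelikeHypersurface, S.IsCauchy →
            MultiTime.CompactlySupportedOn ψ (S.power N ∩ MultiTime.orderedConfigs N)) →
          ∀ S S' : MultiTime.SpacelikeHypersurface, S.IsCauchy → S'.IsCauchy →
            MultiTime.ProbabilityConserved ψ S S') ∧
        (∀ S S' : MultiTime.SpacelikeHypersurface,
          MultiTime.CompactlySupportedOn ψ (MultiTime.sweptRegion N S S') →
            MultiTime.ProbabilityConserved ψ S S')) := by
  refine ⟨fun hvan => ?_, fun φ _ hphase => ?_⟩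
  · have hswap := hvan.swapInvariant
    exact ⟨MultiTime.probabilityConserved_of_isCauchy hcont hdiff hdirac hswap,
      MultiTime.probabilityConserved_of_sweptRegion hcont hdiff hdirac hswap⟩
  · have hswap := hphase.swapInvariant
    exact ⟨hswap.currentFormVanishes,
      MultiTime.probabilityConserved_of_isCauchy hcont hdiff hdirac hswap,
      MultiTime.probabilityConserved_of_sweptRegion hcont hdiff hdirac hswap⟩
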